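/- **Setting.** Let $\mathrm{HTop}$ be the category of topological spaces and homotopy classes of continuous maps, and $\mathrm{HPol}$ its full subcategory of spaces having the homotopy type of a polyhedron, i.e. of the geometric realization (with the weak topology) of a simplicial complex. An $\mathrm{HPol}$-expansion $\mathbf q:Y\to(Y_\mu,q_{\mu\mu'},M)$ of a space $Y$ is an inverse system in $\mathrm{HPol}$ over a directed set $M$ with morphisms $q_\mu:Y\to Y_\mu$ in $\mathrm{HTop}$ satisfying $q_{\mu\mu'}q_{\mu'}=q_\mu$ for $\mu\le\mu'$, such that for every $P$ in $\mathrm{HPol}$: (E1) every $h:Y\to P$ factors as $h=fq_\mu$ for some $\mu$ and some $f:Y_\mu\to P$; (E2) if $f_0,f_1:Y_\mu\to P$ satisfy $f_0q_\mu=f_1q_\mu$, then $f_0q_{\mu\mu'}=f_1q_{\mu\mu'}$ for some $\mu'\ge\mu$. An $S^*$-morphism $(f,f^n_\mu):(X_\lambda,p_{\lambda\lambda'},\Lambda)\to(Y_\mu,q_{\mu\mu'},M)$ consists of a function $f:M\to\Lambda$ and morphisms $f^n_\mu:X_{f(\mu)}\to Y_\mu$ ($n\in\mathbb N$, $\mu\in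 M$) such that for all $\mu\le\mu'$ there are $\lambda\ge f(\mu),f(\mu')$ and $n$ with $q_{\mu\mu'}f^{n'}_{\mu'}p_{f(\mu')\lambda}=f^{n'}_\mu p_{f(\mu)\lambda}$ for all $n'\ge n$. Two $S^*$-morphisms $(f,f^n_\mu)$, $(g,g^n_\mu)$ are equivalent if for every $\mu$ there are $\lambda\ge f(\mu),g(\mu)$ and $n$ with $f^{n'}_\mu p_{f(\mu)\lambda}=g^{n'}_\mu p_{g(\mu)\lambda}$ for all $n'\ge n$. Inverse systems with the equivalence classes of $S^*$-morphisms (composed by $(g,g^n_\nu)(f,f^n_\mu)=(fg,\,g^n_\nu f^n_{g(\nu)})$) form the category $\mathrm{pro}^*$. The set $Sh^*(X,Y)$ of coarse shape morphisms consists of the $\mathrm{pro}^*$-morphisms $\mathbf f^*:\mathbf X\to\mathbf Y$ between $\mathrm{HPol}$-expansions of $X$ and of $Y$, where $\mathbf f^*:\mathbf X\to\mathbf Y$ and $\mathbf f'^*:\mathbf X'\to\mathbf Y'$ are identified if $\mathbf j\mathbf f^*=\mathbf f'^*\mathbf i$ for the canonical isomorphisms $\mathbf i:\mathbf X\to\mathbf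 X'$, $\mathbf j:\mathbf Y\to\mathbf Y'$ of expansions; composition is composition of representatives, and each $q_\mu:Y\to Y_\mu$ induces a coarse shape morphism, again written $q_\mu$. For a directed set $M$, let $L(M)$ be the set of lower classes of $M$ (subsets $\Delta$ such that $\mu\le\delta\in\Delta$ implies $\mu\in\Delta$), partially ordered by $\Delta\le\Delta'\iff\Delta\supseteq\Delta'$, with least element $0=M$; put $[\mu]=\{\mu'\in M:\mu'\le\mu\}$. An ultrametric on a set $S$ with values in a poset $\Gamma$ with least element $0$ is a map $d:S\times S\to\Gamma$ such that for all $x,y,z\in S$ and $\gamma\in\Gamma$: $d(x,y)=0\iff x=y$; $d(x,y)=d(y,x)$; and $d(x,y)\le\gamma$, $d(y,z)\le\gamma$ imply $d(x,z)\le\gamma$. **Theorem.** Let $X$ and $Y$ be topological spaces. For every $\mathrm{HPol}$-expansion $\mathbf q:Y\to(Y_\mu,q_{\mu\mu'},M)$ of $Y$ and all $F^*,G^*\in Sh^*(X,Y)$ put $$d_{\mathbf q}(F^*,G^*)=\{\mu\in M:\ q_\mu\circ F^*=q_\mu\circ G^*\}.$$ 1. Each $d_{\mathbf q}(F^*,G^*)$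 is a lower class, and $d_{\mathbf q}:Sh^*(X,Y)\times Sh^*(X,Y)\to L(M)$ is an ultrametric. 2. The balls $B_{[\mu]}(F^*)=\{G^*\in Sh^*(X,Y): d_{\mathbf q}(F^*,G^*)\le[\mu]\}$, for $\mu\in M$ and $F^*\in Sh^*(X,Y)$, form a basis of a topology on $Sh^*(X,Y)$. 3. This topology does not depend on the $\mathrm{HPol}$-expansion $\mathbf q$ of $Y$. 4. It equals the topology $T_{\mathbf q}$ on $Sh^*(X,Y)$ generated by the sets $V_\mu^{F^*}=\{G^*\in Sh^*(X,Y): q_\mu\circ F^*=q_\mu\circ G^*\}$, for $\mu\in M$ and $F^*\in Sh^*(X,Y)$. -/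

import Mathlib

open CategoryTheory

universe u v w

/-! ### The homotopy category and the homotopy category of polyhedra -/

/-- The relation of homotopy on continuous maps. -/
def homotopyRel : HomRel TopCat.{u} := fun _ _ f g => ContinuousMap.Homotopic f.hom g.hom

/-- `HTop`: topological spaces and homotopy classes of continuous maps. -/
abbrev HTop : Type (u + 1) := CategoryTheory.Quotient homotopyRel.{u}

/-- A topological space, regarded as an object of `HTop`. -/
abbrev HTop.of (X : Type u) [TopologicalSpace X] : HTop.{u} := ⟨TopCat.of X⟩

/-- The underlying set of the geometric realization `|K|` of an abstract simplicial complex,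
in barycentric coordinates. -/
def Realization {V : Type u} (K : PreAbstractSimplicialComplex V) : Type u :=
  {x : V →₀ ℝ // x.support ∈ K ∧ (∀ v, 0 ≤ x v) ∧ (x.sum fun _ t => t) = 1}

/-- The closed simplex of `|K|` spanned by the finite set `s` of vertices. -/
def Realization.closedSimplex {V : Type u} (K : PreAbstractSimplicialComplex V) (s : Finset V) :
    Type u :=
  {x : Realization K // x.1.support ⊆ s}

/-- The Euclidean topology of a closed simplex: its points have all their nonzero coordinates
in the finite set `s`, so this is the topology of finitely many real coordinates. -/
instance {V : Type u} (K : PreAbstractSimplicialComplex V) (s : Finset V) :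
    TopologicalSpace (Realization.closedSimplex K s) :=
  TopologicalSpace.induced (fun x (v : V) => x.1.1 v) inferInstance

/-- The weak (CW, coherent) topology on `|K|`: a set is open if and only if its trace on the
closed simplex of every face is open there. -/
instance {V : Type u} (K : PreAbstractSimplicialComplex V) :
    TopologicalSpace (Realization K) :=
  ⨆ s : K.faces, TopologicalSpace.coinduced
    (fun x : Realization.closedSimplex K s.1 => x.1) inferInstance

/-- `HPol`, as a full subcategory of `HTop`: the spaces which have the homotopy type of a
polyhedron. -/
def HPol : ObjectProperty HTop.{u} := fun X =>
  ∃ (V : Type u) (K : PreAbstractSimplicialComplex V),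
    Nonempty (ContinuousMap.HomotopyEquiv X.as (Realization K))

/-! ### Inverse systems and their morphisms -/

/-- An inverse system in `T` over a (nonempty) directed preordered set. -/
structure InvSys (T : Type v) [Category.{w} T] where
  Idx : Type u
  [preorder : Preorder Idx]
  [directed : IsDirectedOrder Idx]
  [nonempty : Nonempty Idx]
  obj : Idx → T
  map : ∀ {a b : Idx}, a ≤ b → (obj b ⟶ obj a)
  map_refl : ∀ a, map (le_refl a) = 𝟙 (obj a)
  map_trans : ∀ {a b c : Idx} (h : a ≤ b) (h' : b ≤ c), map h' ≫ map h = map (h.trans h')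

attribute [instance] InvSys.preorder InvSys.directed InvSys.nonempty

section General

variable {T : Type v} [Category.{w} T]

/-- A representative `(f, f_μ)` of a morphism of inverse systems in `pro-T`. -/
structure SMor (X Y : InvSys.{u} T) where
  idx : Y.Idx → X.Idx
  hom : ∀ m, X.obj (idx m) ⟶ Y.obj m
  comm : ∀ {m m' : Y.Idx} (h : m ≤ m'), ∃ (l : X.Idx) (h₁ : idx m ≤ l) (h₂ : idx m' ≤ l),
    X.map h₂ ≫ hom m' ≫ Y.map h = X.map h₁ ≫ hom m

/-- An `S*`-morphism `(f, f^n_μ)` of inverse systems. -/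
structure SStarMor (X Y : InvSys.{u} T) where
  idx : Y.Idx → X.Idx
  hom : ℕ → ∀ m, X.obj (idx m) ⟶ Y.obj m
  comm : ∀ {m m' : Y.Idx} (h : m ≤ m'), ∃ (l : X.Idx) (h₁ : idx m ≤ l) (h₂ : idx m' ≤ l) (n : ℕ),
    ∀ n' ≥ n, X.map h₂ ≫ hom n' m' ≫ Y.map h = X.map h₁ ≫ hom n' m

/-- The `S*`-morphism with `f^n_μ = f_μ` for all `n`. -/
def SMor.toStar {X Y : InvSys.{u} T} (f : SMor X Y) : SStarMor X Y where
  idx := f.idx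
  hom _ := f.hom
  comm h := by
    obtain ⟨l, h₁, h₂, e⟩ := f.comm h
    exact ⟨l, h₁, h₂, 0, fun _ _ => e⟩

namespace SStarMor

/-- Equivalence of `S*`-morphisms. -/
def Equivalent {X Y : InvSys.{u} T} (f g : SStarMor X Y) : Prop :=
  ∀ m : Y.Idx, ∃ (l : X.Idx) (h₁ : f.idx m ≤ l) (h₂ : g.idx m ≤ l) (n : ℕ),
    ∀ n' ≥ n, X.map h₁ ≫ f.hom n' m = X.map h₂ ≫ g.hom n' m

/-- Pull an equation along a bonding morphism. -/
theorem lift_eq {X : InvSys.{u} T} {a b l l' : X.Idx} {h₁ : a ≤ l} {h₂ : b ≤ l} {Z : T}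
    {f : X.obj a ⟶ Z} {g : X.obj b ⟶ Z} (e : X.map h₁ ≫ f = X.map h₂ ≫ g) (h : l ≤ l') :
    X.map (h₁.trans h) ≫ f = X.map (h₂.trans h) ≫ g := by
  rw [← X.map_trans h₁ h, ← X.map_trans h₂ h, Category.assoc, Category.assoc, e]

instance setoid (X Y : InvSys.{u} T) : Setoid (SStarMor X Y) where
  r := Equivalent
  iseqv :=
    { refl := fun f m => ⟨f.idx m, le_rfl, le_rfl, 0, fun _ _ => rfl⟩
      symm := fun h m => by
        obtain ⟨l, h₁, h₂, n, e⟩ := h m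
        exact ⟨l, h₂, h₁, n, fun n' hn => (e n' hn).symm⟩
      trans := fun h h' m => by
        obtain ⟨l, h₁, h₂, n, e⟩ := h m
        obtain ⟨l', h₁', h₂', n', e'⟩ := h' m
        obtain ⟨k, hk, hk'⟩ := exists_ge_ge l l'
        exact ⟨k, h₁.trans hk, h₂'.trans hk', max n n', fun i hi =>
          (lift_eq (e i (le_of_max_le_left hi)) hk).trans
            (lift_eq (e' i (le_of_max_le_right hi)) hk')⟩ }

/-- The identity `S*`-morphism. -/
def id (X : InvSys.{u} T) : SStarMor X X where
  idx m := m
  hom _ m := 𝟙 _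
  comm {m m'} h := ⟨m', h, le_rfl, 0, fun _ _ => by simp [X.map_refl]⟩

/-- Composition of `S*`-morphisms: first `f`, then `g`. -/
def comp {X Y Z : InvSys.{u} T} (f : SStarMor X Y) (g : SStarMor Y Z) : SStarMor X Z where
  idx m := f.idx (g.idx m)
  hom n m := f.hom n (g.idx m) ≫ g.hom n m
  comm {m m'} h := by
    obtain ⟨l, h₁, h₂, n, e⟩ := g.comm h
    obtain ⟨k₁, a₁, b₁, n₁, e₁⟩ := f.comm h₁
    obtain ⟨k₂, a₂, b₂, n₂, e₂⟩ := f.comm h₂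
    obtain ⟨k, hk₁, hk₂⟩ := exists_ge_ge k₁ k₂
    refine ⟨k, a₁.trans hk₁, a₂.trans hk₂, max n (max n₁ n₂), fun i hi => ?_⟩
    have E := e i (by omega)
    have E₁ := lift_eq (by simpa using e₁ i (by omega)) hk₁
    have E₂ := lift_eq (by simpa using e₂ i (by omega)) hk₂
    calc X.map (a₂.trans hk₂) ≫ (f.hom i (g.idx m') ≫ g.hom i m') ≫ Z.map h
        = (X.map (a₂.trans hk₂) ≫ f.hom i (g.idx m')) ≫ g.hom i m' ≫ Z.map h := by simp
      _ = (X.map (b₂.trans hk₂) ≫ f.hom i l ≫ Y.map h₂) ≫ g.hom i m' ≫ Z.map h := by rw [E₂]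
      _ = X.map (b₂.trans hk₂) ≫ f.hom i l ≫ (Y.map h₂ ≫ g.hom i m' ≫ Z.map h) := by simp
      _ = (X.map (b₁.trans hk₁) ≫ f.hom i l ≫ Y.map h₁) ≫ g.hom i m := by rw [E]; simp
      _ = X.map (a₁.trans hk₁) ≫ f.hom i (g.idx m) ≫ g.hom i m := by rw [E₁]; simp

theorem id_comp {X Y : InvSys.{u} T} (f : SStarMor X Y) : (id X).comp f = f := by
  cases f; simp [comp, id]

theorem comp_id {X Y : InvSys.{u} T} (f : SStarMor X Y) : f.comp (id Y) = f := by
  cases f; simp [comp, id]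

theorem comp_assoc {X Y Z W : InvSys.{u} T} (f : SStarMor X Y) (g : SStarMor Y Z)
    (h : SStarMor Z W) : (f.comp g).comp h = f.comp (g.comp h) := by
  simp [comp]

theorem comp_equivalent {X Y Z : InvSys.{u} T} {f f' : SStarMor X Y} {g g' : SStarMor Y Z}
    (hf : f ≈ f') (hg : g ≈ g') : f.comp g ≈ f'.comp g' := by
  intro m
  obtain ⟨l, h₁, h₂, n, e⟩ := hg m
  obtain ⟨k₁, a₁, b₁, n₁, e₁⟩ := f.comm h₁
  obtain ⟨k₂, a₂, b₂, n₂, e₂⟩ := f'.comm h₂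
  obtain ⟨k₃, a₃, b₃, n₃, e₃⟩ := hf l
  obtain ⟨k, hk₁, hk₂, hk₃⟩ : ∃ k, k₁ ≤ k ∧ k₂ ≤ k ∧ k₃ ≤ k := by
    obtain ⟨k', h, h'⟩ := exists_ge_ge k₁ k₂
    obtain ⟨k, h'', h'''⟩ := exists_ge_ge k' k₃
    exact ⟨k, h.trans h'', h'.trans h'', h'''⟩
  refine ⟨k, a₁.trans hk₁, a₂.trans hk₂, max n (max n₁ (max n₂ n₃)), fun i hi => ?_⟩
  have E := e i (by omega)
  have E₁ := lift_eq (by simpa using e₁ i (by omega)) hk₁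
  have E₂ := lift_eq (by simpa using e₂ i (by omega)) hk₂
  have E₃ := lift_eq (e₃ i (by omega)) hk₃
  calc X.map (a₁.trans hk₁) ≫ f.hom i (g.idx m) ≫ g.hom i m
      = (X.map (a₁.trans hk₁) ≫ f.hom i (g.idx m)) ≫ g.hom i m := by simp
    _ = (X.map (b₁.trans hk₁) ≫ f.hom i l ≫ Y.map h₁) ≫ g.hom i m := by rw [E₁]
    _ = (X.map (a₃.trans hk₃) ≫ f.hom i l) ≫ Y.map h₁ ≫ g.hom i m := by simp
    _ = (X.map (b₂.trans hk₂) ≫ f'.hom i l ≫ Y.map h₂) ≫ g'.hom i m := by rw [E₃, E]; simp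
    _ = X.map (a₂.trans hk₂) ≫ f'.hom i (g'.idx m) ≫ g'.hom i m := by rw [E₂]; simp

end SStarMor

/-- The category `pro*-T`: inverse systems in `T`, and equivalence classes of `S*`-morphisms. -/
instance : Category (InvSys.{u} T) where
  Hom X Y := _root_.Quotient (SStarMor.setoid X Y)
  id X := ⟦SStarMor.id X⟧
  comp f g := Quotient.map₂ SStarMor.comp
    (fun _ _ hf _ _ hg => SStarMor.comp_equivalent hf hg) f g
  id_comp f := by
    induction f using Quotient.inductionOn with
    | _ f => exact congrArg (Quotient.mk _) f.id_comp
  comp_id f := by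
    induction f using Quotient.inductionOn with
    | _ f => exact congrArg (Quotient.mk _) f.comp_id
  assoc f g h := by
    induction f using Quotient.inductionOn with
    | _ f =>
    induction g using Quotient.inductionOn with
    | _ g =>
    induction h using Quotient.inductionOn with
    | _ h => exact congrArg (Quotient.mk _) (f.comp_assoc g h)

/-- The morphism of `pro*-T` represented by an `S*`-morphism. -/
def SStarMor.toHom {X Y : InvSys.{u} T} (f : SStarMor X Y) : X ⟶ Y :=
  Quotient.mk (SStarMor.setoid X Y) f

/-- The identity representative in `pro-T`. -/
def SMor.id (X : InvSys.{u} T) : SMor X X where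
  idx m := m
  hom m := 𝟙 _
  comm {m m'} h := ⟨m', h, le_rfl, by simp [X.map_refl]⟩

/-! ### Expansions -/

/-- A `P`-expansion `p : X ⟶ (X_a, p_ab)` of an object `X` of `T`, for a full subcategory `P`
of `T`. A morphism of `pro-T` from `X` (a system with a single term) to an inverse system is a
family of morphisms `proj a : X ⟶ X_a` compatible with the bonding morphisms. -/
structure Expansion (P : ObjectProperty T) (X : T) where
  sys : InvSys.{u} T
  mem : ∀ a, P (sys.obj a)
  proj : ∀ a, X ⟶ sys.obj a
  proj_map : ∀ {a b : sys.Idx} (h : a ≤ b), proj b ≫ sys.map h = proj a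
  exists_factor : ∀ (Q : T), P Q → ∀ h : X ⟶ Q, ∃ (a : sys.Idx) (f : sys.obj a ⟶ Q),
    proj a ≫ f = h
  factor_unique : ∀ (Q : T), P Q → ∀ (a : sys.Idx) (f₀ f₁ : sys.obj a ⟶ Q),
    proj a ≫ f₀ = proj a ≫ f₁ → ∃ (b : sys.Idx) (h : a ≤ b), sys.map h ≫ f₀ = sys.map h ≫ f₁

namespace Expansion

variable {P : ObjectProperty T}

/-- The rudimentary expansion of an object of `P`, with a single term. -/
def rudimentary {Q : T} (hQ : P Q) : Expansion.{u} P Q where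
  sys :=
    { Idx := PUnit
      obj := fun _ => Q
      map := fun _ => 𝟙 Q
      map_refl := fun _ => rfl
      map_trans := fun _ _ => Category.comp_id _ }
  mem _ := hQ
  proj _ := 𝟙 Q
  proj_map _ := Category.comp_id _
  exists_factor _ _ h := ⟨PUnit.unit, h, Category.id_comp h⟩
  factor_unique _ _ a _ _ e := ⟨a, le_rfl, e⟩

/-- `f : 𝐗 ⟶ 𝐘` in `pro-P` satisfies `f p = q h` in `pro-T`. -/
def IsLift {X Y : T} (p : Expansion.{u} P X) (q : Expansion.{u} P Y) (h : X ⟶ Y)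
    (f : SMor p.sys q.sys) : Prop :=
  ∀ m, p.proj (f.idx m) ≫ f.hom m = h ≫ q.proj m

theorem exists_isLift {X Y : T} (p : Expansion.{u} P X) (q : Expansion.{u} P Y) (h : X ⟶ Y) :
    ∃ f : SMor p.sys q.sys, IsLift p q h f := by
  choose idx hom e using fun m => p.exists_factor _ (q.mem m) (h ≫ q.proj m)
  refine ⟨⟨idx, hom, ?_⟩, e⟩
  intro m m' hm
  obtain ⟨l, h₁, h₂⟩ := exists_ge_ge (idx m) (idx m')
  obtain ⟨k, hk, E⟩ := p.factor_unique _ (q.mem m) l (p.sys.map h₂ ≫ hom m' ≫ q.sys.map hm)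
    (p.sys.map h₁ ≫ hom m) (by
      rw [← Category.assoc, ← Category.assoc, ← Category.assoc, p.proj_map, p.proj_map, e, e,
        Category.assoc, q.proj_map])
  refine ⟨k, h₁.trans hk, h₂.trans hk, ?_⟩
  rw [← p.sys.map_trans h₁ hk, ← p.sys.map_trans h₂ hk, Category.assoc, Category.assoc, E]

theorem IsLift.unique {X Y : T} {p : Expansion.{u} P X} {q : Expansion.{u} P Y} {h : X ⟶ Y}
    {f g : SMor p.sys q.sys} (hf : IsLift p q h f) (hg : IsLift p q h g) :
    f.toStar.toHom = g.toStar.toHom := by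
  refine Quotient.sound fun m => ?_
  obtain ⟨l, h₁, h₂⟩ := exists_ge_ge (f.idx m) (g.idx m)
  obtain ⟨k, hk, E⟩ := p.factor_unique _ (q.mem m) l (p.sys.map h₁ ≫ f.hom m)
    (p.sys.map h₂ ≫ g.hom m) (by
      rw [← Category.assoc, ← Category.assoc, p.proj_map, p.proj_map, hf, hg])
  refine ⟨k, h₁.trans hk, h₂.trans hk, 0, fun _ _ => ?_⟩
  change p.sys.map (h₁.trans hk) ≫ f.hom m = p.sys.map (h₂.trans hk) ≫ g.hom m
  rw [← p.sys.map_trans h₁ hk, ← p.sys.map_trans h₂ hk, Category.assoc, Category.assoc, E]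

/-- For `h : X ⟶ Y`, the unique morphism `f : 𝐗 ⟶ 𝐘` of `pro-P` with `f p = q h`, regarded as a
morphism of `pro*-P`. For `X = Y` and `h = 𝟙 X` it is the canonical isomorphism between two
expansions of `X`. -/
noncomputable def lift {X Y : T} (p : Expansion.{u} P X) (q : Expansion.{u} P Y) (h : X ⟶ Y) :
    p.sys ⟶ q.sys :=
  (exists_isLift p q h).choose.toStar.toHom

theorem IsLift.eq {X Y : T} {p : Expansion.{u} P X} {q : Expansion.{u} P Y} {h : X ⟶ Y}
    {f : SMor p.sys q.sys} (hf : IsLift p q h f) : lift p q h = f.toStar.toHom :=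
  (exists_isLift p q h).choose_spec.unique hf

theorem lift_id {X : T} (p : Expansion.{u} P X) : lift p p (𝟙 X) = 𝟙 p.sys :=
  IsLift.eq (f := SMor.id p.sys) fun m => by simp [SMor.id]

theorem lift_comp {X Y Z : T} (p : Expansion.{u} P X) (q : Expansion.{u} P Y)
    (r : Expansion.{u} P Z) (h : X ⟶ Y) (k : Y ⟶ Z) :
    lift p q h ≫ lift q r k = lift p r (h ≫ k) := by
  obtain ⟨f, hf⟩ := exists_isLift p q h
  obtain ⟨g, hg⟩ := exists_isLift q r k
  obtain ⟨e, he⟩ := exists_isLift p r (h ≫ k)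
  rw [hf.eq, hg.eq, he.eq]
  refine Quotient.sound fun m => ?_
  obtain ⟨l, h₁, h₂⟩ := exists_ge_ge (f.idx (g.idx m)) (e.idx m)
  obtain ⟨b, hb, E⟩ := p.factor_unique _ (r.mem m) l (p.sys.map h₁ ≫ f.hom (g.idx m) ≫ g.hom m)
    (p.sys.map h₂ ≫ e.hom m) (by
      rw [← Category.assoc, ← Category.assoc, ← Category.assoc, p.proj_map, p.proj_map, hf, he,
        Category.assoc, hg, Category.assoc])
  refine ⟨b, h₁.trans hb, h₂.trans hb, 0, fun _ _ => ?_⟩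
  change p.sys.map (h₁.trans hb) ≫ f.hom (g.idx m) ≫ g.hom m =
    p.sys.map (h₂.trans hb) ≫ e.hom m
  rw [← p.sys.map_trans h₁ hb, ← p.sys.map_trans h₂ hb, Category.assoc, Category.assoc, E]

end Expansion

/-! ### Coarse shape morphisms -/

/-- A morphism `𝐗 ⟶ 𝐘` of `pro*-P` between expansions of `X` and `Y`. -/
structure CoarseRep (P : ObjectProperty T) (X Y : T) where
  dom : Expansion.{u} P X
  cod : Expansion.{u} P Y
  hom : dom.sys ⟶ cod.sys

/-- The `pro*-P` equivalence: `f : 𝐗 ⟶ 𝐘` and `f' : 𝐗' ⟶ 𝐘'` are equivalent if `j f = f' i`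
for the canonical isomorphisms `i : 𝐗 ⟶ 𝐗'` and `j : 𝐘 ⟶ 𝐘'`. -/
instance CoarseRep.setoid (P : ObjectProperty T) (X Y : T) : Setoid (CoarseRep.{u} P X Y) where
  r f f' := f.hom ≫ Expansion.lift f.cod f'.cod (𝟙 Y) =
    Expansion.lift f.dom f'.dom (𝟙 X) ≫ f'.hom
  iseqv :=
    { refl := fun f => by simp [Expansion.lift_id]
      symm := fun {f f'} e => by
        have h := congrArg (fun t => Expansion.lift f'.dom f.dom (𝟙 X) ≫ t ≫
          Expansion.lift f'.cod f.cod (𝟙 Y)) e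
        simp only [Category.assoc, Expansion.lift_comp, Category.comp_id, Expansion.lift_id] at h
        rw [← Category.assoc, Expansion.lift_comp, Category.comp_id, Expansion.lift_id,
          ← Category.assoc, Category.id_comp] at h
        simpa using h.symm
      trans := fun {f f' f''} e e' => by
        have h : (f.hom ≫ Expansion.lift f.cod f'.cod (𝟙 Y)) ≫
            Expansion.lift f'.cod f''.cod (𝟙 Y) =
            Expansion.lift f.dom f'.dom (𝟙 X) ≫ Expansion.lift f'.dom f''.dom (𝟙 X) ≫
              f''.hom := by rw [e, Category.assoc, e']
        rwa [Category.assoc, Expansion.lift_comp, ← Category.assoc (Expansion.lift _ _ _),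
          Expansion.lift_comp, Category.comp_id, Category.comp_id] at h }

/-- The set of coarse shape morphisms `X ⟶ Y` for the pair `(T, P)`. -/
def CoarseShapeHom (P : ObjectProperty T) (X Y : T) :=
  _root_.Quotient (CoarseRep.setoid.{u} P X Y)

namespace CoarseShapeHom

variable {P : ObjectProperty T}

/-- Composition `G ∘ F` of coarse shape morphisms `F : X ⟶ Y` and `G : Y ⟶ Z`, given by the
composition of representatives, the expansions of `Y` used in them being identified through the
canonical isomorphism. -/
noncomputable def comp {X Y Z : T} (G : CoarseShapeHom.{u} P Y Z) (F : CoarseShapeHom.{u} P X Y) :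
    CoarseShapeHom.{u} P X Z :=
  Quotient.map₂
    (fun g f : CoarseRep.{u} P _ _ =>
      (⟨f.dom, g.cod, f.hom ≫ Expansion.lift f.cod g.dom (𝟙 Y) ≫ g.hom⟩ : CoarseRep.{u} P X Z))
    (fun g g' hg f f' hf => by
      have hg : g.hom ≫ _ = _ ≫ g'.hom := hg
      have hf : f.hom ≫ _ = _ ≫ f'.hom := hf
      change (f.hom ≫ Expansion.lift f.cod g.dom (𝟙 Y) ≫ g.hom) ≫
        Expansion.lift g.cod g'.cod (𝟙 Z) = Expansion.lift f.dom f'.dom (𝟙 X) ≫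
          f'.hom ≫ Expansion.lift f'.cod g'.dom (𝟙 Y) ≫ g'.hom
      rw [← Category.assoc (Expansion.lift f.dom _ _), ← hf, Category.assoc, Category.assoc, hg,
        Category.assoc, ← Category.assoc (Expansion.lift f.cod _ _), Expansion.lift_comp,
        ← Category.assoc (Expansion.lift f.cod _ _), Expansion.lift_comp])
    G F

/-- The coarse shape morphism `S*(h)` induced by a morphism `h : X ⟶ Y` of `T`, computed from
expansions of `X` and `Y`; by the next lemma, it does not depend on them. -/
noncomputable def ofHom {X Y : T} (p : Expansion.{u} P X) (q : Expansion.{u} P Y) (h : X ⟶ Y) :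
    CoarseShapeHom.{u} P X Y :=
  Quotient.mk _ ⟨p, q, Expansion.lift p q h⟩

theorem ofHom_eq {X Y : T} (p p' : Expansion.{u} P X) (q q' : Expansion.{u} P Y) (h : X ⟶ Y) :
    ofHom p q h = ofHom p' q' h := by
  refine Quotient.sound ?_
  change Expansion.lift p q h ≫ Expansion.lift q q' (𝟙 Y) =
    Expansion.lift p p' (𝟙 X) ≫ Expansion.lift p' q' h
  simp [Expansion.lift_comp]

end CoarseShapeHom

/-- The morphism `q_m : Y ⟶ Y_m` of a `P`-expansion of `Y`, as a coarse shape morphism. -/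
noncomputable def Expansion.coarseProj {P : ObjectProperty T} {Y : T} (q : Expansion.{u} P Y)
    (m : q.sys.Idx) : CoarseShapeHom.{u} P Y (q.sys.obj m) :=
  CoarseShapeHom.ofHom q (Expansion.rudimentary (q.mem m)) (q.proj m)

end General

/-! ### Topologies and ultrametrics on sets of coarse shape morphisms of spaces -/

/-- An ultrametric with values in a partially ordered set with a least element. -/
structure IsUltrametric {S : Type*} {Γ : Type*} [PartialOrder Γ] [OrderBot Γ] (d : S → S → Γ) :
    Prop where
  eq_bot_iff : ∀ x y, d x y = ⊥ ↔ x = y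
  symm : ∀ x y, d x y = d y x
  ultra : ∀ x y z c, d x y ≤ c → d y z ≤ c → d x z ≤ c

/-- An `HPol`-expansion of a topological space. -/
abbrev HPolExpansion (Y : Type u) [TopologicalSpace Y] := Expansion.{u} HPol.{u} (HTop.of Y)

/-- The set `Sh*(X, Y)` of coarse shape morphisms between topological spaces. -/
abbrev ShStar (X Y : Type u) [TopologicalSpace X] [TopologicalSpace Y] :=
  CoarseShapeHom.{u} HPol.{u} (HTop.of X) (HTop.of Y)

/-- The poset `L(M)` of lower classes of `M`, in which `Δ ≤ Δ'` means `Δ ⊇ Δ'`; its least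
element is `M` itself. -/
abbrev LowerClasses (M : Type u) [Preorder M] := (LowerSet M)ᵒᵈ

/-- The lower class `[m]` generated by `m`. -/
def LowerClasses.principal {M : Type u} [Preorder M] (m : M) : LowerClasses M :=
  OrderDual.toDual (LowerSet.Iic m)

section Topologies

variable {X Y : Type u} [TopologicalSpace X] [TopologicalSpace Y]

/-- The set `V_m^F` of all `G` with `q_m ∘ G = q_m ∘ F`. -/
def basicSet (q : HPolExpansion Y) (m : q.sys.Idx) (F : ShStar X Y) : Set (ShStar X Y) :=
  {G | (q.coarseProj m).comp F = (q.coarseProj m).comp G}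

/-- The topology `T_q` on `Sh*(X, Y)` with the sets `V_m^F` as a basis. -/
abbrev coarseTopology (q : HPolExpansion Y) : TopologicalSpace (ShStar X Y) :=
  TopologicalSpace.generateFrom {U | ∃ F m, U = basicSet q m F}

/-- The family of all balls `B_[m](F) = {G | d(F, G) ≤ [m]}`. -/
def balls {S M : Type*} [Preorder M] (d : S → S → LowerClasses M) : Set (Set S) :=
  {U | ∃ (F : S) (m : M), U = {G | d F G ≤ LowerClasses.principal m}}

end Topologies

/-! Once expansions `p` of X and `q` of Y are fixed, coarse shape morphisms are the same as
morphisms `p.sys ⟶ q.sys` of pro* (`exists_rep`, `mk_eq_mk_iff`), and composing with an induced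
morphism is composing with its lift (`ofHom_comp_mk`). Three facts follow. Equivalence of
S*-morphisms is tested one index at a time, so the projections to the terms are jointly injective
(`coarseShapeHom_ext`), which makes distance zero mean equality. Agreement after `h` persists after
`h ≫ k` (`ofHom_comp_eq_of_factor`); with `k` a bonding morphism this makes the distance a lower
class. With `k` given by (E1), each term of one expansion is controlled by a term of any other
(`exists_coarseProj_comp_eq`), so the topologies coincide. Balls are literally the sets V, and those
form a basis because M is directed and nonempty. -/

/-! ### Representatives over fixed expansions -/

namespace CoarseShapeHom

variable {T : Type v} [Category.{w} T] {P : ObjectProperty T} {X Y : T}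

/-- The coarse shape morphism represented by a morphism between expansions. -/
def mk (p : Expansion.{u} P X) (q : Expansion.{u} P Y) (f : p.sys ⟶ q.sys) :
    CoarseShapeHom.{u} P X Y :=
  Quotient.mk _ ⟨p, q, f⟩

/-- Every coarse shape morphism is represented by a morphism between given expansions. -/
theorem exists_rep (p : Expansion.{u} P X) (q : Expansion.{u} P Y) (F : CoarseShapeHom.{u} P X Y) :
    ∃ f : p.sys ⟶ q.sys, mk p q f = F := by
  induction F using Quotient.inductionOn with
  | _ r =>
  refine ⟨Expansion.lift p r.dom (𝟙 X) ≫ r.hom ≫ Expansion.lift r.cod q (𝟙 Y), Quotient.sound ?_⟩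
  change (Expansion.lift p r.dom (𝟙 X) ≫ r.hom ≫ Expansion.lift r.cod q (𝟙 Y)) ≫
    Expansion.lift q r.cod (𝟙 Y) = Expansion.lift p r.dom (𝟙 X) ≫ r.hom
  simp [Expansion.lift_comp, Expansion.lift_id]

/-- Morphisms between fixed expansions represent the same coarse shape morphism only if they are
equal. -/
theorem mk_eq_mk_iff (p : Expansion.{u} P X) (q : Expansion.{u} P Y) (f g : p.sys ⟶ q.sys) :
    mk p q f = mk p q g ↔ f = g := by
  -- The canonical isomorphism of an expansion with itself is the identity, so the defining square
  -- collapses.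
  have key : (⟨p, q, f⟩ : CoarseRep.{u} P X Y) ≈ ⟨p, q, g⟩ ↔ f = g := by
    change f ≫ Expansion.lift q q (𝟙 Y) = Expansion.lift p p (𝟙 X) ≫ g ↔ f = g
    rw [Expansion.lift_id, Expansion.lift_id, Category.comp_id, Category.id_comp]
  exact Quotient.eq.trans key

/-- Composing with the morphism induced by `h : Y ⟶ Z`, in terms of representatives. -/
theorem ofHom_comp_mk {Z : T} (p : Expansion.{u} P X) (q : Expansion.{u} P Y)
    (r : Expansion.{u} P Z) (h : Y ⟶ Z) (f : p.sys ⟶ q.sys) :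
    (ofHom q r h).comp (mk p q f) = mk p r (f ≫ Expansion.lift q r h) := by
  change mk p r (f ≫ Expansion.lift q q (𝟙 Y) ≫ Expansion.lift q r h) = _
  rw [Expansion.lift_id, Category.id_comp]

/-- If `F` and `G` agree after composition with `h`, they agree after composition with `h ≫ k`. -/
theorem ofHom_comp_eq_of_factor {Z W : T} (q : Expansion.{u} P Y) (r : Expansion.{u} P Z)
    (s : Expansion.{u} P W) (h : Y ⟶ Z) (k : Z ⟶ W) {F G : CoarseShapeHom.{u} P X Y}
    (e : (ofHom q r h).comp F = (ofHom q r h).comp G) :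
    (ofHom q s (h ≫ k)).comp F = (ofHom q s (h ≫ k)).comp G := by
  -- A representative of `F` supplies an expansion of X, so no existence theorem for expansions is
  -- needed.
  obtain ⟨p⟩ : Nonempty (Expansion.{u} P X) := by
    induction F using Quotient.inductionOn with
    | _ a => exact ⟨a.dom⟩
  obtain ⟨f, rfl⟩ := exists_rep p q F
  obtain ⟨g, rfl⟩ := exists_rep p q G
  rw [ofHom_comp_mk, ofHom_comp_mk, mk_eq_mk_iff] at e
  rw [ofHom_comp_mk, ofHom_comp_mk, ← Expansion.lift_comp q r s, ← Category.assoc, e,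
    Category.assoc]

end CoarseShapeHom

/-! ### Projections to the terms of an expansion -/

namespace Expansion

variable {T : Type v} [Category.{w} T] {P : ObjectProperty T} {X Y : T}

/-- The morphism from a system to one of its terms, with identity components. -/
def termProj (q : Expansion.{u} P Y) (m : q.sys.Idx) :
    SMor q.sys (rudimentary.{u} (q.mem m)).sys where
  idx _ := m
  hom _ := 𝟙 (q.sys.obj m)
  comm _ := ⟨m, le_rfl, le_rfl, by simp [rudimentary]⟩

/-- Replaces a lift obtained by choice with an explicit representative, so that components can be
computed. -/
theorem lift_rudimentary_proj (q : Expansion.{u} P Y) (m : q.sys.Idx) :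
    lift q (rudimentary (q.mem m)) (q.proj m) = (termProj q m).toStar.toHom :=
  IsLift.eq fun _ => rfl

/-- Morphisms of `pro*` which agree after projection to every term are equal. -/
theorem hom_ext (q : Expansion.{u} P Y) {S : InvSys.{u} T} {f g : S ⟶ q.sys}
    (h : ∀ m, f ≫ lift q (rudimentary (q.mem m)) (q.proj m) =
      g ≫ lift q (rudimentary (q.mem m)) (q.proj m)) : f = g := by
  induction f using Quotient.inductionOn with
  | _ f =>
  induction g using Quotient.inductionOn with
  | _ g =>
  refine Quotient.sound fun m => ?_
  have hm := h m
  rw [lift_rudimentary_proj] at hm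
  -- At the only index of the one-term system, equivalence of the composites is the condition at `m`
  -- for `f` and `g`, up to identity factors.
  obtain ⟨l, (h₁ : f.idx m ≤ l), (h₂ : g.idx m ≤ l), n, e⟩ := Quotient.exact hm PUnit.unit
  refine ⟨l, h₁, h₂, n, fun i hi => ?_⟩
  have ei : S.map h₁ ≫ f.hom i m ≫ 𝟙 (q.sys.obj m) = S.map h₂ ≫ g.hom i m ≫ 𝟙 (q.sys.obj m) :=
    e i hi
  rwa [Category.comp_id, Category.comp_id] at ei

/-- Coarse shape morphisms which agree after projection to every term of an expansion are equal. -/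
theorem coarseShapeHom_ext (q : Expansion.{u} P Y) {F G : CoarseShapeHom.{u} P X Y}
    (h : ∀ m, (q.coarseProj m).comp F = (q.coarseProj m).comp G) : F = G := by
  obtain ⟨p⟩ : Nonempty (Expansion.{u} P X) := by
    induction F using Quotient.inductionOn with
    | _ a => exact ⟨a.dom⟩
  obtain ⟨f, rfl⟩ := CoarseShapeHom.exists_rep p q F
  obtain ⟨g, rfl⟩ := CoarseShapeHom.exists_rep p q G
  refine congrArg (CoarseShapeHom.mk p q) (q.hom_ext fun m => ?_)
  have hm := h m
  rwa [coarseProj, CoarseShapeHom.ofHom_comp_mk, CoarseShapeHom.ofHom_comp_mk,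
    CoarseShapeHom.mk_eq_mk_iff] at hm

/-- Every term of an expansion separates less than a suitable term of any other expansion. -/
theorem exists_coarseProj_comp_eq (q q' : Expansion.{u} P Y) (m' : q'.sys.Idx) :
    ∃ m : q.sys.Idx, ∀ {F G : CoarseShapeHom.{u} P X Y},
      (q.coarseProj m).comp F = (q.coarseProj m).comp G →
        (q'.coarseProj m').comp F = (q'.coarseProj m').comp G := by
  obtain ⟨m, k, hk⟩ := q.exists_factor _ (q'.mem m') (q'.proj m')
  refine ⟨m, fun {F G} e => ?_⟩
  have h := CoarseShapeHom.ofHom_comp_eq_of_factor q _ (rudimentary (q'.mem m')) _ k e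
  -- So far `q'.proj m'` is computed from the expansion `q` of Y; the coarse shape morphism it
  -- induces is the same when computed from `q'`.
  rwa [hk, CoarseShapeHom.ofHom_eq q q' _ (rudimentary (q'.mem m'))] at h

theorem coarseProj_comp_eq_of_le (q : Expansion.{u} P Y) {m m' : q.sys.Idx} (hm : m ≤ m')
    {F G : CoarseShapeHom.{u} P X Y} (e : (q.coarseProj m').comp F = (q.coarseProj m').comp G) :
    (q.coarseProj m).comp F = (q.coarseProj m).comp G := by
  have h := CoarseShapeHom.ofHom_comp_eq_of_factor q _ (rudimentary (q.mem m)) _ (q.sys.map hm) e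
  rwa [q.proj_map] at h

end Expansion

/-! ### The ultrametric and its topology -/

section ShStarTopology

variable {X Y : Type u} [TopologicalSpace X] [TopologicalSpace Y]

/-- The ultrametric `d_q` on `Sh*(X, Y)`. -/
def coarseDist (q : HPolExpansion Y) (F G : ShStar X Y) : LowerClasses q.sys.Idx :=
  OrderDual.toDual
    ⟨{m | (q.coarseProj m).comp F = (q.coarseProj m).comp G},
      fun _ _ hm e => q.coarseProj_comp_eq_of_le hm e⟩

theorem mem_coarseDist (q : HPolExpansion Y) (F G : ShStar X Y) (m : q.sys.Idx) :
    m ∈ OrderDual.ofDual (coarseDist q F G) ↔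
      (q.coarseProj m).comp F = (q.coarseProj m).comp G :=
  Iff.rfl

theorem isUltrametric_coarseDist (q : HPolExpansion Y) :
    IsUltrametric (coarseDist q : ShStar X Y → ShStar X Y → LowerClasses q.sys.Idx) where
  eq_bot_iff F G := by
    constructor
    · intro h
      -- The least element of the reversed order is all of M, so the hypothesis gives agreement at
      -- every term.
      refine q.coarseShapeHom_ext fun m => (mem_coarseDist q F G m).1 ?_
      rw [h]
      exact LowerSet.mem_top
    · rintro rfl
      exact OrderDual.ofDual.injective (LowerSet.ext (Set.eq_univ_of_forall fun _ => rfl))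
  symm F G := OrderDual.ofDual.injective (LowerSet.ext (Set.ext fun _ => eq_comm))
  ultra F G H c h h' := fun m hm =>
    ((mem_coarseDist q F G m).1 (h hm)).trans ((mem_coarseDist q G H m).1 (h' hm))

/-- The order is reverse inclusion, and a lower class contains [m] exactly when it contains `m`. -/
theorem coarseDist_le_principal_iff (q : HPolExpansion Y) (F G : ShStar X Y) (m : q.sys.Idx) :
    coarseDist q F G ≤ LowerClasses.principal m ↔ G ∈ basicSet q m F :=
  (LowerSet.Iic_le (s := OrderDual.ofDual (coarseDist q F G)))

theorem balls_coarseDist (q : HPolExpansion Y) :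
    balls (coarseDist q : ShStar X Y → ShStar X Y → LowerClasses q.sys.Idx) =
      {U | ∃ F m, U = basicSet q m F} := by
  simp only [balls, coarseDist_le_principal_iff, Set.ofPred_mem_eq]

theorem isTopologicalBasis_basicSet (q : HPolExpansion Y) :
    @TopologicalSpace.IsTopologicalBasis _ (coarseTopology q)
      {U : Set (ShStar X Y) | ∃ F m, U = basicSet q m F} := by
  refine @TopologicalSpace.IsTopologicalBasis.mk _ (coarseTopology q) _ ?_ ?_ rfl
  · rintro _ ⟨F₁, m₁, rfl⟩ _ ⟨F₂, m₂, rfl⟩ G ⟨h₁, h₂⟩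
    obtain ⟨m, hm₁, hm₂⟩ := exists_ge_ge m₁ m₂
    -- The smaller set is centred at `G` itself, at an index above both given ones; agreement there
    -- passes down to each.
    exact ⟨_, ⟨G, m, rfl⟩, rfl, fun H hH =>
      ⟨Eq.trans h₁ (q.coarseProj_comp_eq_of_le hm₁ hH),
        Eq.trans h₂ (q.coarseProj_comp_eq_of_le hm₂ hH)⟩⟩
  · obtain ⟨m⟩ := q.sys.nonempty
    exact Set.eq_univ_of_forall fun F => ⟨_, ⟨F, m, rfl⟩, rfl⟩

/-- Around each point `G` of a basic set for `q'`, the set V centred at `G` at a controlling index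
of `q` stays inside it. Exchanging `q` and `q'` then yields equality. -/
theorem coarseTopology_le (q q' : HPolExpansion Y) :
    (coarseTopology q : TopologicalSpace (ShStar X Y)) ≤ coarseTopology q' := by
  refine le_generateFrom ?_
  rintro _ ⟨F, m', rfl⟩
  obtain ⟨m, hm⟩ := q.exists_coarseProj_comp_eq (X := HTop.of X) q' m'
  refine (@TopologicalSpace.IsTopologicalBasis.isOpen_iff _ (coarseTopology q) _ _
    (isTopologicalBasis_basicSet q)).2 fun G hG => ?_
  exact ⟨_, ⟨G, m, rfl⟩, rfl, fun H hH => Eq.trans hG (hm hH)⟩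

theorem coarseTopology_eq (q q' : HPolExpansion Y) :
    (coarseTopology q : TopologicalSpace (ShStar X Y)) = coarseTopology q' :=
  le_antisymm (coarseTopology_le q q') (coarseTopology_le q' q)

end ShStarTopology

theorem theorem3p6 (X Y : Type u) [TopologicalSpace X] [TopologicalSpace Y] :
    ∃ d : ∀ q : HPolExpansion Y, ShStar X Y → ShStar X Y → LowerClasses q.sys.Idx,
      (∀ q F G m, m ∈ OrderDual.ofDual (d q F G) ↔
        (q.coarseProj m).comp F = (q.coarseProj m).comp G) ∧
      (∀ q, IsUltrametric (d q)) ∧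
      (∀ q, @TopologicalSpace.IsTopologicalBasis _
        (TopologicalSpace.generateFrom (balls (d q))) (balls (d q))) ∧
      (∀ q q', TopologicalSpace.generateFrom (balls (d q)) =
        TopologicalSpace.generateFrom (balls (d q'))) ∧
      (∀ q, TopologicalSpace.generateFrom (balls (d q)) = coarseTopology q) := by
  refine ⟨coarseDist, mem_coarseDist, isUltrametric_coarseDist, fun q => ?_, fun q q' => ?_,
    fun q => ?_⟩
  · rw [balls_coarseDist]
    exact isTopologicalBasis_basicSet q
  · rw [balls_coarseDist, balls_coarseDist]
    exact coarseTopology_eq q q'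
  · rw [balls_coarseDist]
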